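/- Let $X$ be a (real or complex) Banach space with norm $\|\cdot\|$. A topological space $(T,\tau)$ is *fragmented by a metric* $\rho$ on $T$ if for every $\varepsilon>0$ every nonempty subset $C\subseteq T$ contains a nonempty $\tau$-relatively open subset of $\rho$-diameter less than $\varepsilon$; it is *fragmentable by a metric* if such a $\rho$ exists. (a) If the norm of $X$ is rotund (strictly convex), i.e. the unit sphere $\{x\in X:\|x\|=1\}$ contains no nontrivial line segment, then $(X,\text{weak})$ is fragmentable by a metric. (b) If the norm of $X$ is weakly locally uniformly rotund, i.e. $x_n-x\to 0$ weakly whenever $x\in X$ and $(x_n)$ is a sequence in $X$ with $\lim_{n\to\infty}\|(x_n+x)/2\|=\lim_{n\to\infty}\|x_n\|=\|x\|$, then $(X,\text{weak})$ is fragmented by a metric which is stronger than the norm topology, i.e. by a metric whose topology contains the norm topology of $X$. -/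

import Mathlib

open Filter Topology

/-- The set `A` is fragmented by the metric `d` down to `ε` with respect to the topology `τ`: each
nonempty `C ⊆ A` has a nonempty `τ`-relatively open subset `C ∩ U` of `d`-diameter less than `ε`.
The diameter takes values in `[0, ∞]`, so an unbounded set has infinite diameter. -/
def FragmentedDownTo {T : Type*} (τ : TopologicalSpace T) (d : MetricSpace T) (A : Set T)
    (ε : ℝ) : Prop :=
  ∀ C : Set T, C ⊆ A → C.Nonempty →
    ∃ U : Set T, IsOpen[τ] U ∧ (C ∩ U).Nonempty ∧ Metric.ediam (C ∩ U) < ENNReal.ofReal ε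

/-- The set `A` is fragmented by the metric `d` with respect to the topology `τ`. -/
def FragmentedBy {T : Type*} (τ : TopologicalSpace T) (d : MetricSpace T) (A : Set T) : Prop :=
  ∀ ε : ℝ, 0 < ε → FragmentedDownTo τ d A ε

/-- The topological space `(T, τ)` is fragmented by some metric. -/
def FragmentableByMetric {T : Type*} (τ : TopologicalSpace T) : Prop :=
  ∃ d : MetricSpace T, FragmentedBy τ d Set.univ

/-- The topological space `(T, τ)` is fragmented by some metric whose topology contains the
topology `σ` (in Mathlib's order, finer topologies are smaller). -/
def FragmentableByMetricStrongerThan {T : Type*} (τ σ : TopologicalSpace T) : Prop :=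
  ∃ d : MetricSpace T, d.toUniformSpace.toTopologicalSpace ≤ σ ∧ FragmentedBy τ d Set.univ

/-- The weak topology `σ(X, X*)`, as a topology on `X` itself. -/
noncomputable abbrev weakTopology (𝕜 X : Type*) [RCLike 𝕜] [NormedAddCommGroup X] [NormedSpace 𝕜 X] :
    TopologicalSpace X :=
  TopologicalSpace.induced (toWeakSpace 𝕜 X) inferInstance

/-- The norm topology of `X`. -/
abbrev normTopology (X : Type*) [NormedAddCommGroup X] : TopologicalSpace X :=
  inferInstance

/-- The norm of `X` is rotund (strictly convex): the unit sphere contains no nontrivial line segment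
`{(1 - t) x + t y : t ∈ [0, 1]}`, `x ≠ y`. -/
def RotundNorm (𝕜 X : Type*) [RCLike 𝕜] [NormedAddCommGroup X] [NormedSpace 𝕜 X] : Prop :=
  ∀ x y : X, x ≠ y →
    ¬ ∀ t : ℝ, 0 ≤ t → t ≤ 1 → ((1 - t : ℝ) : 𝕜) • x + (t : 𝕜) • y ∈ Metric.sphere (0 : X) 1

/-- The norm of `X` is weakly locally uniformly rotund: `x n - x → 0` weakly whenever
`lim ‖(x n + x) / 2‖ = lim ‖x n‖ = ‖x‖`. -/
def WeaklyLocallyUniformlyRotundNorm (𝕜 X : Type*) [RCLike 𝕜] [NormedAddCommGroup X]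
    [NormedSpace 𝕜 X] : Prop :=
  ∀ (x : X) (u : ℕ → X),
    Tendsto (fun n => ‖(2 : 𝕜)⁻¹ • (u n + x)‖) atTop (𝓝 ‖x‖) →
    Tendsto (fun n => ‖u n‖) atTop (𝓝 ‖x‖) →
    Tendsto (fun n => u n - x) atTop (@nhds X (weakTopology 𝕜 X) 0)

/-!
Call an equivalence relation on a topological space `T` *openly fragmented* if every nonempty
`C ⊆ T` has a nonempty relatively open subset contained in a single class. This property is stable
under finite intersections, and a countable separating family of such relations yields a
fragmenting metric: embed `T` into the product of the (discrete) quotients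
(`exists_metricSpace_fragmentedBy`). Every class of every relation in the family is then
open for the metric, which is how the metric topology is compared with a given one.

For a Banach space with its weak topology and `q : ℚ`, the set `{x | q < ‖x‖}` is the union of the
slices `{x | q < re (f x)}` with `‖f‖ ≤ 1`. Well-order the functionals and send each `x` to the first
slice containing it (or to nothing if `‖x‖ ≤ q`); the fibres are the classes of an openly fragmented
relation (`exists_slice_setoid`). Two equivalent points either both have norm at most `q`, or lie in
a common slice and so have a midpoint of norm greater than `q`.

If the norm is rotund, and `x ≠ y` have the same norm, then a rational `q` between the norm of their
midpoint and `‖x‖` separates them; points of different norms are separated by any rational between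
the two.

If the norm is weakly locally uniformly rotund, a sequence that is eventually equivalent to `x` for
each `q` converges weakly to `x` (`tendsto_weak_of_eventually_slice`). In each class of the
intersection of the first `n` relations pick a point, and let `p n x` be the point picked in the
class of `x`. Then `p n x → x` weakly, so by Mazur's theorem `x` lies in the norm closed span of the
`p n x`. On a class, `p 0 x, …, p (k - 1) x` do not depend on `x` once `k` is at most the number of
relations intersected, and norm balls are weakly closed; hence cutting each class along the ball of
radius `ε` about a fixed combination `∑ i < k, a i • p i x` gives again an openly fragmented relation.
Countably many such cuts give classes of arbitrarily small norm diameter around every point.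
-/

/-! ### Openly fragmented equivalence relations -/

/-- Every nonempty set has a nonempty relatively open subset contained in a single class of `s`.
The partition is encoded by its equivalence relation. -/
def OpenlyFragmented {T : Type*} (τ : TopologicalSpace T) (s : Setoid T) : Prop :=
  ∀ C : Set T, C.Nonempty → ∃ U : Set T, IsOpen[τ] U ∧ (C ∩ U).Nonempty ∧
    ∀ x ∈ C ∩ U, ∀ y ∈ C ∩ U, s x y

theorem OpenlyFragmented.inf {T : Type*} {τ : TopologicalSpace T} {s t : Setoid T}
    (hs : OpenlyFragmented τ s) (ht : OpenlyFragmented τ t) : OpenlyFragmented τ (s ⊓ t) := by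
  intro C hC
  obtain ⟨U, hU, hCU, h1⟩ := hs C hC
  obtain ⟨V, hV, hCV, h2⟩ := ht _ hCU
  refine ⟨U ∩ V, hU.inter hV, by rwa [← Set.inter_assoc], fun x hx y hy => ?_⟩
  rw [← Set.inter_assoc] at hx hy
  exact ⟨h1 x hx.1 y hy.1, h2 x hx y hy⟩

theorem OpenlyFragmented.finset_inf {T ι : Type*} {τ : TopologicalSpace T} {s : ι → Setoid T}
    (hs : ∀ i, OpenlyFragmented τ (s i)) (F : Finset ι) : OpenlyFragmented τ (F.inf s) := by
  refine Finset.inf_induction (p := OpenlyFragmented τ) ?_ (fun _ h _ h' => h.inf h')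
    fun i _ => hs i
  exact fun C hC => ⟨Set.univ, isOpen_univ, by simpa using hC, fun _ _ _ _ => trivial⟩

/-- A relation stays openly fragmented when each class is cut into a relatively open part and its
complement. -/
theorem OpenlyFragmented.inf_ker {T : Type*} {τ : TopologicalSpace T} {s : Setoid T}
    (hs : OpenlyFragmented τ s) (A : Set T)
    (hA : ∀ x, ∃ O : Set T, IsOpen[τ] O ∧ ∀ y, s x y → (y ∈ O ↔ y ∈ A)) :
    OpenlyFragmented τ (s ⊓ Setoid.ker (· ∈ A)) := by
  intro C hC
  obtain ⟨U, hU, ⟨x, hx⟩, h1⟩ := hs C hC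
  obtain ⟨O, hO, hOA⟩ := hA x
  by_cases h : (C ∩ (U ∩ O)).Nonempty
  · refine ⟨U ∩ O, hU.inter hO, h, fun y hy z hz => ⟨h1 y ⟨hy.1, hy.2.1⟩ z ⟨hz.1, hz.2.1⟩, ?_⟩⟩
    have hy' := (hOA y (h1 x hx y ⟨hy.1, hy.2.1⟩)).1 hy.2.2
    have hz' := (hOA z (h1 x hx z ⟨hz.1, hz.2.1⟩)).1 hz.2.2
    exact propext ⟨fun _ => hz', fun _ => hy'⟩
  · have key : ∀ y ∈ C ∩ U, y ∉ A := fun y hy hyA =>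
      h ⟨y, hy.1, hy.2, (hOA y (h1 x hx y hy)).2 hyA⟩
    refine ⟨U, hU, ⟨x, hx⟩, fun y hy z hz => ⟨h1 y hy z hz, ?_⟩⟩
    exact propext ⟨fun h' => (key y hy h').elim, fun h' => (key z hz h').elim⟩

/-- The relation "same first member containing the point" attached to a well-ordered family of open
sets. -/
theorem exists_openlyFragmented_of_isOpen {T κ : Type*} {τ : TopologicalSpace T} (V : κ → Set T)
    (hV : ∀ k, IsOpen[τ] (V k)) :
    ∃ s : Setoid T, OpenlyFragmented τ s ∧ ∀ x y, s x y →
      (∃ k, x ∈ V k ∧ y ∈ V k) ∨ ((∀ k, x ∉ V k) ∧ ∀ k, y ∉ V k) := by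
  classical
  obtain ⟨_, _⟩ := exists_wellFoundedLT κ
  let g : T → Option κ := fun x =>
    if h : {k | x ∈ V k}.Nonempty then some (wellFounded_lt.min _ h) else none
  refine ⟨Setoid.ker g, ?_, ?_⟩
  · intro C hC
    by_cases h : {k | (C ∩ V k).Nonempty}.Nonempty
    · have hk := wellFounded_lt.min_mem _ h
      set k := wellFounded_lt.min _ h
      have hg : ∀ x ∈ C ∩ V k, g x = some k := by
        intro x hx
        have hne : {k | x ∈ V k}.Nonempty := ⟨k, hx.2⟩
        have h1 : ¬ k < wellFounded_lt.min _ hne := wellFounded_lt.not_lt_min {k | x ∈ V k} hx.2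
        have h2 : ¬ wellFounded_lt.min _ hne < k :=
          wellFounded_lt.not_lt_min {k | (C ∩ V k).Nonempty}
            ⟨x, hx.1, wellFounded_lt.min_mem _ hne⟩
        simp only [g, dif_pos hne]
        exact congrArg some (le_antisymm (not_lt.1 h1) (not_lt.1 h2))
      exact ⟨V k, hV k, hk, fun x hx y hy => (hg x hx).trans (hg y hy).symm⟩
    · have hg : ∀ x ∈ C, g x = none := by
        intro x hx
        refine dif_neg ?_
        rintro ⟨k, hk⟩
        exact h ⟨k, x, hx, hk⟩
      exact ⟨Set.univ, isOpen_univ, by simpa using hC,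
        fun x hx y hy => (hg x hx.1).trans (hg y hy.1).symm⟩
  · intro x y hxy
    have hxy : g x = g y := hxy
    by_cases hx : {k | x ∈ V k}.Nonempty
    · by_cases hy : {k | y ∈ V k}.Nonempty
      · simp only [g, dif_pos hx, dif_pos hy, Option.some.injEq] at hxy
        exact Or.inl ⟨_, wellFounded_lt.min_mem _ hx, hxy ▸ wellFounded_lt.min_mem _ hy⟩
      · simp [g, dif_pos hx, dif_neg hy] at hxy
    · by_cases hy : {k | y ∈ V k}.Nonempty
      · simp [g, dif_neg hx, dif_pos hy] at hxy
      · exact Or.inr ⟨fun k hk => hx ⟨k, hk⟩, fun k hk => hy ⟨k, hk⟩⟩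

theorem exists_metricSpace_fragmentedBy {T ι : Type*} [Countable ι] [Nonempty ι]
    (τ : TopologicalSpace T) (s : ι → Setoid T) (hs : ∀ i, OpenlyFragmented τ (s i))
    (hsep : ∀ x y, (∀ i, s i x y) → x = y) :
    ∃ d : MetricSpace T, FragmentedBy τ d Set.univ ∧
      ∀ i x, {y | s i x y} ∈ @nhds T d.toUniformSpace.toTopologicalSpace x := by
  obtain ⟨e, he⟩ := exists_surjective_nat ι
  let E : ℕ → Type _ := fun n => Quotient (s (e n))
  let Φ : T → ∀ n, E n := fun x n => Quotient.mk (s (e n)) x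
  let : ∀ n, TopologicalSpace (E n) := fun n => ⊥
  have : ∀ n, DiscreteTopology (E n) := fun n => ⟨rfl⟩
  let m : MetricSpace (∀ n, E n) := PiNat.metricSpace
  have hΦ : Function.Injective Φ := by
    intro x y hxy
    refine hsep x y fun i => ?_
    obtain ⟨n, rfl⟩ := he i
    exact Quotient.exact (congrFun hxy n)
  let d : MetricSpace T := MetricSpace.induced Φ hΦ m
  have hd : ∀ x y : T, dist x y = @dist _ PiNat.dist (Φ x) (Φ y) := fun _ _ => rfl
  refine ⟨d, ?_, fun i x => ?_⟩
  · intro ε hε C _ hC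
    obtain ⟨n, hn⟩ := exists_pow_lt_of_lt_one hε (by norm_num : (1 / 2 : ℝ) < 1)
    obtain ⟨U, hU, hCU, h⟩ :=
      OpenlyFragmented.finset_inf (s := fun n => s (e n)) (fun n => hs _) (Finset.range n) C hC
    refine ⟨U, hU, hCU, lt_of_le_of_lt (Metric.ediam_le (d := ENNReal.ofReal ((1 / 2) ^ n)) ?_)
      ((ENNReal.ofReal_lt_ofReal_iff hε).2 hn)⟩
    intro x hx y hy
    rw [edist_dist]
    refine ENNReal.ofReal_le_ofReal ?_
    rw [hd]
    refine PiNat.mem_cylinder_iff_dist_le.1 fun i hi => Quotient.sound ?_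
    exact Finset.inf_le (f := fun n => s (e n)) (Finset.mem_range.2 hi) (h x hx y hy)
  · obtain ⟨n, rfl⟩ := he i
    refine Filter.mem_of_superset (Metric.ball_mem_nhds x (ε := (1 / 2) ^ n) (by positivity)) ?_
    intro y hy
    rw [Metric.mem_ball, dist_comm, hd] at hy
    exact Quotient.exact (PiNat.apply_eq_of_dist_lt hy le_rfl)

/-! ### Slices in the weak topology -/

section Weak

variable {𝕜 X : Type*} [RCLike 𝕜] [NormedAddCommGroup X] [NormedSpace 𝕜 X]

theorem continuous_weakTopology_dual (f : StrongDual 𝕜 X) :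
    @Continuous X 𝕜 (weakTopology 𝕜 X) _ f := by
  have h : Continuous fun x : WeakSpace 𝕜 X => f ((toWeakSpace 𝕜 X).symm x) :=
    WeakBilin.eval_continuous (topDualPairing 𝕜 X).flip f
  exact @Continuous.mk X 𝕜 (weakTopology 𝕜 X) _ f fun U hU => ⟨_, hU.preimage h, rfl⟩

theorem isOpen_weakTopology_slice (f : StrongDual 𝕜 X) (c : X) (q : ℝ) :
    IsOpen[weakTopology 𝕜 X] {x | q < RCLike.re (f (x - c))} := by
  have h : IsOpen {z : 𝕜 | q < RCLike.re (z - f c)} := isOpen_lt continuous_const (by fun_prop)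
  simp only [map_sub f]
  exact @IsOpen.preimage X 𝕜 (weakTopology 𝕜 X) _ f (continuous_weakTopology_dual f) _ h

theorem re_dual_le_norm {f : StrongDual 𝕜 X} (hf : ‖f‖ ≤ 1) (x : X) :
    RCLike.re (f x) ≤ ‖x‖ :=
  (RCLike.re_le_norm _).trans ((f.le_opNorm x).trans (mul_le_of_le_one_left (norm_nonneg _) hf))

theorem isOpen_weakTopology_norm_gt (𝕜 : Type*) {X : Type*} [RCLike 𝕜] [NormedAddCommGroup X]
    [NormedSpace 𝕜 X] (c : X) (q : ℝ) : IsOpen[weakTopology 𝕜 X] {x | q < ‖x - c‖} := by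
  have : {x : X | q < ‖x - c‖} =
      ⋃ f : {f : StrongDual 𝕜 X // ‖f‖ ≤ 1}, {x | q < RCLike.re (f.1 (x - c))} := by
    ext x
    simp only [Set.mem_ofPred_eq, Set.mem_iUnion]
    constructor
    · intro h
      obtain ⟨g, hg, hgx⟩ := exists_dual_vector'' 𝕜 (x - c)
      exact ⟨⟨g, hg⟩, by simpa [hgx] using h⟩
    · rintro ⟨f, hf⟩
      exact hf.trans_le (re_dual_le_norm f.2 _)
  rw [this]
  exact @isOpen_iUnion _ _ (weakTopology 𝕜 X) _ fun f => isOpen_weakTopology_slice f.1 c q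

/-- A class of this relation either lies in the ball of radius `q`, or lies in a slice disjoint from
that ball; slices are convex, so in the second case the midpoints avoid the ball too. -/
theorem exists_slice_setoid (𝕜 X : Type*) [RCLike 𝕜] [NormedAddCommGroup X] [NormedSpace 𝕜 X]
    (q : ℝ) : ∃ s : Setoid X, OpenlyFragmented (weakTopology 𝕜 X) s ∧ ∀ x y, s x y →
      (q < ‖x‖ ∧ q < ‖y‖ ∧ q < ‖(2 : 𝕜)⁻¹ • (y + x)‖) ∨ (‖x‖ ≤ q ∧ ‖y‖ ≤ q) := by
  obtain ⟨s, hs, h⟩ := exists_openlyFragmented_of_isOpen (τ := weakTopology 𝕜 X)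
    (fun f : {f : StrongDual 𝕜 X // ‖f‖ ≤ 1} => {x | q < RCLike.re (f.1 (x - 0))})
    fun f => isOpen_weakTopology_slice f.1 0 q
  refine ⟨s, hs, fun x y hxy => (h x y hxy).imp ?_ ?_⟩
  · rintro ⟨⟨f, hf⟩, hx, hy⟩
    simp only [sub_zero, Set.mem_ofPred_eq] at hx hy
    refine ⟨hx.trans_le (re_dual_le_norm hf _), hy.trans_le (re_dual_le_norm hf _),
      lt_of_lt_of_le ?_ (re_dual_le_norm hf _)⟩
    have h2 : (2 : 𝕜)⁻¹ = ((2⁻¹ : ℝ) : 𝕜) := by push_cast; rfl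
    rw [map_smul, map_add, smul_eq_mul, h2, RCLike.re_ofReal_mul, map_add]
    linarith
  · have key : ∀ z : X, (∀ f : {f : StrongDual 𝕜 X // ‖f‖ ≤ 1},
        z ∉ {x | q < RCLike.re (f.1 (x - 0))}) → ‖z‖ ≤ q := by
      intro z hz
      obtain ⟨g, hg, hgz⟩ := exists_dual_vector'' 𝕜 z
      simpa [hgz] using hz ⟨g, hg⟩
    exact fun ⟨hx, hy⟩ => ⟨key x hx, key y hy⟩

/-! ### Rotund norms -/

theorem RotundNorm.norm_midpoint_lt (h : RotundNorm 𝕜 X) {x y : X} (hxy : x ≠ y)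
    (hn : ‖x‖ = ‖y‖) : ‖(2 : 𝕜)⁻¹ • (y + x)‖ < ‖x‖ := by
  let : NormedSpace ℝ X := NormedSpace.restrictScalars ℝ 𝕜 X
  have hsm : ∀ (t : ℝ) (z : X), t • z = (t : 𝕜) • z := fun t z => by
    rw [← algebraMap_smul 𝕜 t z]
  have : StrictConvexSpace ℝ X := by
    refine StrictConvexSpace.of_norm_combo_ne_one fun u v _ _ huv => ?_
    have := h u v huv
    push Not at this
    obtain ⟨t, h0, h1, ht⟩ := this
    refine ⟨1 - t, t, by linarith, h0, by ring, ?_⟩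
    rw [hsm, hsm]
    simpa only [mem_sphere_zero_iff_norm] using ht
  have := (norm_midpoint_lt_iff hn).2 hxy
  rw [hsm, add_comm] at this
  rwa [show ((1 / 2 : ℝ) : 𝕜) = (2 : 𝕜)⁻¹ by push_cast; exact one_div _] at this

theorem RotundNorm.fragmentableByMetric (h : RotundNorm 𝕜 X) :
    FragmentableByMetric (weakTopology 𝕜 X) := by
  choose s hs hsep using fun q : ℚ => exists_slice_setoid 𝕜 X (q : ℝ)
  obtain ⟨d, hd, -⟩ := exists_metricSpace_fragmentedBy (weakTopology 𝕜 X) s hs fun x y hxy => by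
    have hle : ∀ {a b : X}, (∀ q, s q a b) → ‖a‖ ≤ ‖b‖ := by
      intro a b hab
      by_contra! hlt
      obtain ⟨q, hq1, hq2⟩ := exists_rat_btwn hlt
      rcases hsep q a b (hab q) with h' | h' <;> linarith [h'.1, h'.2]
    have hn : ‖x‖ = ‖y‖ := le_antisymm (hle hxy) (hle fun q => (s q).symm (hxy q))
    by_contra hne
    obtain ⟨q, hq1, hq2⟩ := exists_rat_btwn (h.norm_midpoint_lt hne hn)
    rcases hsep q x y (hxy q) with h' | h'
    · exact absurd h'.2.2 (not_lt.2 hq1.le)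
    · exact absurd h'.1 (not_le.2 hq2)
  exact ⟨d, hd⟩

/-! ### Weakly locally uniformly rotund norms -/

theorem tendsto_weak_of_eventually_slice (h : WeaklyLocallyUniformlyRotundNorm 𝕜 X)
    {s : ℚ → Setoid X}
    (hsep : ∀ q x y, s q x y →
      ((q : ℝ) < ‖x‖ ∧ (q : ℝ) < ‖y‖ ∧ (q : ℝ) < ‖(2 : 𝕜)⁻¹ • (y + x)‖) ∨
        (‖x‖ ≤ q ∧ ‖y‖ ≤ q))
    {x : X} {u : ℕ → X} (hu : ∀ q, ∀ᶠ n in atTop, s q x (u n)) (f : StrongDual 𝕜 X) :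
    Tendsto (fun n => f (u n)) atTop (𝓝 (f x)) := by
  have hup : ∀ q : ℚ, ‖x‖ < q → ∀ᶠ n in atTop, ‖u n‖ ≤ q := fun q hq => by
    filter_upwards [hu q] with n hn
    rcases hsep q x _ hn with h' | h'
    · exact absurd h'.1 (not_lt.2 hq.le)
    · exact h'.2
  have hlow : ∀ q : ℚ, q < ‖x‖ → ∀ᶠ n in atTop,
      (q : ℝ) < ‖u n‖ ∧ (q : ℝ) < ‖(2 : 𝕜)⁻¹ • (u n + x)‖ := fun q hq => by
    filter_upwards [hu q] with n hn
    rcases hsep q x _ hn with h' | h'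
    · exact h'.2
    · exact absurd h'.1 (not_le.2 hq)
  have h1 : Tendsto (fun n => ‖u n‖) atTop (𝓝 ‖x‖) := by
    refine tendsto_order.2 ⟨fun a ha => ?_, fun a ha => ?_⟩
    · obtain ⟨q, hq1, hq2⟩ := exists_rat_btwn ha
      filter_upwards [hlow q hq2] with n hn using hq1.trans hn.1
    · obtain ⟨q, hq1, hq2⟩ := exists_rat_btwn ha
      filter_upwards [hup q hq1] with n hn using hn.trans_lt hq2
  have h2 : Tendsto (fun n => ‖(2 : 𝕜)⁻¹ • (u n + x)‖) atTop (𝓝 ‖x‖) := by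
    refine tendsto_order.2 ⟨fun a ha => ?_, fun a ha => ?_⟩
    · obtain ⟨q, hq1, hq2⟩ := exists_rat_btwn ha
      filter_upwards [hlow q hq2] with n hn using hq1.trans hn.2
    · obtain ⟨q, hq1, hq2⟩ := exists_rat_btwn ha
      filter_upwards [hup q hq1] with n hn
      rw [norm_smul, norm_inv, RCLike.norm_ofNat]
      linarith [norm_add_le (u n) x]
  have h3 := ((@Continuous.tendsto X 𝕜 (weakTopology 𝕜 X) _ f
    (continuous_weakTopology_dual f) 0).comp (h x u h2 h1)).add_const (f x)
  simpa [Function.comp_def] using h3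

/-- Mazur's theorem, for spans instead of convex hulls. -/
theorem mem_closure_span_of_tendsto_dual {x : X} {u : ℕ → X}
    (hu : ∀ f : StrongDual 𝕜 X, Tendsto (fun n => f (u n)) atTop (𝓝 (f x))) :
    x ∈ closure (Submodule.span 𝕜 (Set.range u) : Set X) := by
  let : NormedSpace ℝ X := NormedSpace.restrictScalars ℝ 𝕜 X
  have : IsScalarTower ℝ 𝕜 X := RestrictScalars.isScalarTower ℝ 𝕜 X
  have hconv : Convex ℝ (Submodule.span 𝕜 (Set.range u) : Set X) :=
    ((Submodule.span 𝕜 (Set.range u)).restrictScalars ℝ).convex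
  have hw : Tendsto (fun n => toWeakSpace 𝕜 X (u n)) atTop (𝓝 (toWeakSpace 𝕜 X x)) :=
    (WeakBilin.tendsto_iff_forall_eval_tendsto (topDualPairing 𝕜 X).flip
      fun y z hyz => (SeparatingDual.eq_iff_forall_dual_eq (R := 𝕜)).2 fun f =>
        LinearMap.congr_fun hyz f).2 hu
  have hmem : toWeakSpace 𝕜 X x ∈
      closure (toWeakSpace 𝕜 X '' (Submodule.span 𝕜 (Set.range u) : Set X)) :=
    mem_closure_of_tendsto hw (Eventually.of_forall fun n =>
      Set.mem_image_of_mem _ (Submodule.subset_span (Set.mem_range_self n)))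
  rw [← hconv.toWeakSpace_closure 𝕜] at hmem
  obtain ⟨z, hz, hzx⟩ := hmem
  rwa [← (toWeakSpace 𝕜 X).injective hzx]

theorem exists_denseSeq_norm_sub_lt {x : X} {u : ℕ → X}
    (hx : x ∈ closure (Submodule.span 𝕜 (Set.range u) : Set X)) {ε : ℝ} (hε : 0 < ε) :
    ∃ k m : ℕ, ‖x - ∑ i ∈ Finset.range k,
      TopologicalSpace.denseSeq (ℕ → 𝕜) m i • u i‖ < ε := by
  obtain ⟨z, hz, hxz⟩ := Metric.mem_closure_iff.1 hx ε hε
  obtain ⟨c, rfl⟩ := Finsupp.mem_span_range_iff_exists_finsupp.1 hz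
  obtain ⟨k, hk⟩ := c.support.exists_nat_subset_range
  rw [Finsupp.sum_of_support_subset _ hk _ (by simp), dist_eq_norm] at hxz
  have hopen : IsOpen {a : ℕ → 𝕜 | ‖x - ∑ i ∈ Finset.range k, a i • u i‖ < ε} :=
    isOpen_lt (by fun_prop) continuous_const
  obtain ⟨m, hm⟩ := (TopologicalSpace.denseRange_denseSeq (ℕ → 𝕜)).exists_mem_open hopen
    ⟨c, hxz⟩
  exact ⟨k, m, hm⟩

theorem WeaklyLocallyUniformlyRotundNorm.fragmentableByMetricStrongerThan
    (h : WeaklyLocallyUniformlyRotundNorm 𝕜 X) :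
    FragmentableByMetricStrongerThan (weakTopology 𝕜 X) (normTopology X) := by
  choose s hs hsep using fun q : ℚ => exists_slice_setoid 𝕜 X (q : ℝ)
  obtain ⟨e, he⟩ := exists_surjective_nat ℚ
  let P : ℕ → Setoid X := fun n => (Finset.range n).inf fun i => s (e i)
  have hP : ∀ n, OpenlyFragmented (weakTopology 𝕜 X) (P n) := fun n =>
    OpenlyFragmented.finset_inf (fun i => hs (e i)) _
  have hPanti : ∀ {m n}, m ≤ n → P n ≤ P m := fun hmn =>
    Finset.inf_mono (Finset.range_subset_range.2 hmn)
  let p : ℕ → X → X := fun n x => (Quotient.mk (P n) x).out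
  have hp : ∀ n x, P n x (p n x) := fun n x => (P n).symm (Quotient.mk_out (s := P n) x)
  have hpP : ∀ {n x y}, P n x y → p n x = p n y := fun hxy =>
    congrArg Quotient.out (Quotient.sound hxy)
  have hspan : ∀ x, x ∈ closure (Submodule.span 𝕜 (Set.range fun n => p n x) : Set X) := by
    refine fun x => mem_closure_span_of_tendsto_dual fun f =>
      tendsto_weak_of_eventually_slice h hsep (fun q => ?_) f
    obtain ⟨i, rfl⟩ := he q
    filter_upwards [eventually_gt_atTop i] with n hn
    exact Finset.inf_le (f := fun i => s (e i)) (Finset.mem_range.2 hn) (hp n x)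
  let c : ℕ → ℕ → X → X := fun k m x =>
    ∑ i ∈ Finset.range k, TopologicalSpace.denseSeq (ℕ → 𝕜) m i • p i x
  have hc : ∀ {k m x y}, P k x y → c k m x = c k m y := fun {k m x y} hxy =>
    Finset.sum_congr rfl fun i hi => by rw [hpP (hPanti (Finset.mem_range.1 hi).le hxy)]
  let r : ℕ → ℝ := fun j => 1 / (j + 1)
  let A : ℕ × ℕ × ℕ → Set X := fun t => {x | r t.2.2 < ‖x - c t.1 t.2.1 x‖}
  let θ : ℕ × ℕ × ℕ → Setoid X := fun t => P t.1 ⊓ Setoid.ker (· ∈ A t)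
  have hθ : ∀ t, OpenlyFragmented (weakTopology 𝕜 X) (θ t) := fun t =>
    (hP t.1).inf_ker (A t) fun x => ⟨{y | r t.2.2 < ‖y - c t.1 t.2.1 x‖},
      isOpen_weakTopology_norm_gt 𝕜 _ _, fun y hxy => by
        simp only [A, Set.mem_ofPred_eq, hc hxy]⟩
  have hsmall : ∀ (x : X) (ε : ℝ), 0 < ε → ∃ t, ∀ y, θ t x y → dist y x < ε := by
    intro x ε hε
    obtain ⟨j, hj⟩ := exists_nat_one_div_lt (half_pos hε)
    obtain ⟨k, m, hkm⟩ := exists_denseSeq_norm_sub_lt (hspan x)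
      (show 0 < r j from Nat.one_div_pos_of_nat)
    have hx : ‖x - c k m x‖ < r j := hkm
    refine ⟨(k, m, j), fun y hxy => ?_⟩
    have hyA : y ∉ A (k, m, j) := fun hy =>
      not_lt.2 hx.le ((Setoid.ker_def.1 hxy.2).mpr hy)
    have hy : ‖y - c k m x‖ ≤ r j := by
      rw [hc hxy.1]
      exact not_lt.1 hyA
    have hr : r j < ε / 2 := hj
    calc dist y x ≤ dist y (c k m x) + dist x (c k m x) := dist_triangle_right _ _ _
      _ < ε := by rw [dist_eq_norm, dist_eq_norm]; linarith
  obtain ⟨d, hd, hnhds⟩ := exists_metricSpace_fragmentedBy (weakTopology 𝕜 X) θ hθ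
    fun x y hxy => by
      refine (eq_of_forall_dist_le fun ε hε => ?_).symm
      obtain ⟨t, ht⟩ := hsmall x ε hε
      exact (ht y (hxy t)).le
  refine ⟨d, ?_, hd⟩
  refine le_of_nhds_le_nhds fun x => ?_
  refine (Metric.nhds_basis_ball (x := x)).ge_iff.2 fun ε hε => ?_
  obtain ⟨t, ht⟩ := hsmall x ε hε
  exact Filter.mem_of_superset (hnhds t x) fun y hy => ht y hy

end Weak

theorem theorem2p4 (𝕜 : Type*) [RCLike 𝕜] (X : Type*) [NormedAddCommGroup X] [NormedSpace 𝕜 X]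
    [CompleteSpace X] :
    (RotundNorm 𝕜 X → FragmentableByMetric (weakTopology 𝕜 X)) ∧
    (WeaklyLocallyUniformlyRotundNorm 𝕜 X →
      FragmentableByMetricStrongerThan (weakTopology 𝕜 X) (normTopology X)) :=
  ⟨RotundNorm.fragmentableByMetric,
    WeaklyLocallyUniformlyRotundNorm.fragmentableByMetricStrongerThan⟩
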